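/- **Definitions.** Let $\Omega$ be a locally compact Hausdorff space, let $\mathbb{K}$ be $\mathbb{R}$ or $\mathbb{C}$, and let $\mathcal{C}(\Omega)$ and $\mathcal{C}_0(\Omega)$ be the algebras of continuous $\mathbb{K}$-valued functions on $\Omega$ and of those vanishing at infinity. Let $\mathbf{Z}(f)=\{x\in\Omega: f(x)=0\}$ and $\mathbf{Z}[\Omega]=\{\mathbf{Z}(f): f\in\mathcal{C}(\Omega)\}$. Let $\Omega\cup\{\infty\}$ be the one-point compactification of $\Omega$ (with $\infty$ isolated if $\Omega$ is compact). For a compact space $X$, let $X^{(1)}$ be the set of limit points of $X$, let $X^{(n+1)}$ be the set of limit points of the subspace $X^{(n)}$ $(n\ge 1)$, and let $X^{(\infty)}=\bigcap_{n\ge 1}X^{(n)}$. A *$z$-filter* on $\Omega$ is a non-empty proper subset of $\mathbf{Z}[\Omega]$ that is closed under finite intersections and under supersets in $\mathbf{Z}[\Omega]$. A $z$-filter $\mathcal{P}$ is *prime* if $Z_1\cup Z_2\notin\mathcal{P}$ whenever $Z_1,Z_2\in\mathbf{Z}[\Omega]\setminus\mathcal{P}$. A prime $z$-filter $\mathcal{P}$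 is *supported at* $p\in\Omega$ if $p\in Z$ for every $Z\in\mathcal{P}$, and *supported at* $\infty$ if no point of $\Omega$ belongs to every $Z\in\mathcal{P}$. Put $\mathbf{Z}^{-1}[\mathcal{P}]=\{f\in\mathcal{C}(\Omega):\mathbf{Z}(f)\in\mathcal{P}\}$. A *prime ideal* of $\mathcal{C}_0(\Omega)$ is a proper ideal $P$ such that $fg\in P$ implies $f\in P$ or $g\in P$. An ideal $I$ of $\mathcal{C}_0(\Omega)$ is a *$z$-ideal* if $g\in I$ whenever $f\in I$, $g\in\mathcal{C}_0(\Omega)$ and $\mathbf{Z}(f)\subset\mathbf{Z}(g)$. A prime ideal $P$ is *supported at* $p\in\Omega$ if $p$ is the unique common zero in $\Omega$ of the functions in $P$, and *supported at* $\infty$ if these functions have no common zero in $\Omega$. A family $(A_i: i\in S)$ of prime $z$-filters, or of prime ideals, is *pseudo-finite* if every element of $\bigcup_{i\in S}A_i$ belongs to $A_i$ for all but finitely many $i\in S$. It is *non-redundant* if $\bigcap_{i\in T}A_i\ne\bigcap_{i\in S}A_i$ for every proper subset $T$ of $S$. **Theorem.** Let $\Omega$ be a locally compact metrizable space, and let $p\in(\Omega\cup\{\infty\})^{(\infty)}$.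 Let $\mathfrak{c}=2^{\aleph_0}$. Then there exists a non-redundant pseudo-finite family $(\mathcal{P}_\alpha:\alpha<\mathfrak{c})$ of prime $z$-filters on $\Omega$, each supported at $p$, such that the sets $$P_\alpha=\mathcal{C}_0(\Omega)\cap\mathbf{Z}^{-1}[\mathcal{P}_\alpha]\qquad(\alpha<\mathfrak{c})$$ form a non-redundant pseudo-finite family of prime $z$-ideals of $\mathcal{C}_0(\Omega)$, each supported at $p$, and $$\Bigl|\,\mathcal{C}_0(\Omega)\big/\bigcap_{\alpha<\mathfrak{c}}P_\alpha\Bigr|=\mathfrak{c}.$$ -/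

import Mathlib

open Set Filter Topology
open scoped ZeroAtInfty OnePoint

namespace PrimeZ

/-- The `n`-th Cantor-Bendixson level of a space `X`: level `0` is `X`, and level `n + 1` is the
set of limit points of level `n` (regarded as a subspace). -/
def cbLevel (X : Type*) [TopologicalSpace X] (n : ℕ) : Set X :=
  CantorBendixson.iteratedDerivedSet (univ : Set X) (n : Ordinal)

theorem cbLevel_zero (X : Type*) [TopologicalSpace X] : cbLevel X 0 = univ := by
  simp [cbLevel]

theorem cbLevel_succ (X : Type*) [TopologicalSpace X] (n : ℕ) :
    cbLevel X (n + 1) = relDerivedSet (cbLevel X n) := by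
  simp [cbLevel]

/-- The intersection of all the finite Cantor-Bendixson levels. -/
def cbLevelInfty (X : Type*) [TopologicalSpace X] : Set X :=
  ⋂ n : ℕ, cbLevel X n

/-- A family of sets is pseudo-finite if each element of the union belongs to all but finitely
many members of the family. -/
def PseudoFinite {ι X : Type*} (P : ι → Set X) : Prop :=
  ∀ x ∈ ⋃ i, P i, {i | x ∉ P i}.Finite

/-- A family of sets is non-redundant if no proper subfamily has the same intersection. -/
def NonRedundant {ι X : Type*} (P : ι → Set X) : Prop :=
  ∀ T : Set ι, T ≠ univ → ⋂ i ∈ T, P i ≠ ⋂ i, P i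

section

variable (𝕜 : Type*) [RCLike 𝕜] (Ω : Type*) [TopologicalSpace Ω]

/-- The family of all zero sets of continuous `𝕜`-valued functions on `Ω`. -/
def zeroSets : Set (Set Ω) :=
  {Z | ∃ f : C(Ω, 𝕜), Z = {x | f x = 0}}

/-- A `z`-filter on `Ω`: a non-empty proper subfamily of the family of zero sets, closed under
finite intersections and under zero sets that are supersets. -/
structure ZFilter where
  /-- The members of the `z`-filter. -/
  sets : Set (Set Ω)
  subset_zeroSets : sets ⊆ zeroSets 𝕜 Ω
  nonempty : sets.Nonempty
  proper : sets ≠ zeroSets 𝕜 Ω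
  inter_mem : ∀ Z₁ ∈ sets, ∀ Z₂ ∈ sets, Z₁ ∩ Z₂ ∈ sets
  mem_of_superset : ∀ Z₁ ∈ sets, ∀ Z₂ ∈ zeroSets 𝕜 Ω, Z₁ ⊆ Z₂ → Z₂ ∈ sets

end

section

variable {𝕜 : Type*} [RCLike 𝕜] {Ω : Type*} [TopologicalSpace Ω]

theorem zeroSet_mem (f : C₀(Ω, 𝕜)) : {x | f x = 0} ∈ zeroSets 𝕜 Ω :=
  ⟨f.toContinuousMap, rfl⟩

/-- A `z`-filter is prime if the union of two zero sets outside it is again outside it. -/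
def ZFilter.IsPrime (F : ZFilter 𝕜 Ω) : Prop :=
  ∀ Z₁ ∈ zeroSets 𝕜 Ω, ∀ Z₂ ∈ zeroSets 𝕜 Ω,
    Z₁ ∉ F.sets → Z₂ ∉ F.sets → Z₁ ∪ Z₂ ∉ F.sets

/-- The `z`-filter `F` is supported at the point `p` of the one-point compactification: if `p` is
a point of `Ω`, then `p` belongs to all members of `F`; if `p` is the point at infinity, then no
point of `Ω` belongs to all members of `F`. -/
def ZFilter.SupportedAt (F : ZFilter 𝕜 Ω) : OnePoint Ω → Prop
  | ∞ => ¬ ∃ q : Ω, ∀ Z ∈ F.sets, q ∈ Z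
  | (p : Ω) => ∀ Z ∈ F.sets, p ∈ Z

/-- The functions in `C₀(Ω, 𝕜)` whose zero set belongs to the `z`-filter `F`. -/
def ZFilter.c0Ideal (F : ZFilter 𝕜 Ω) : Submodule 𝕜 C₀(Ω, 𝕜) where
  carrier := {f | {x | f x = 0} ∈ F.sets}
  zero_mem' := by
    obtain ⟨Z, hZ⟩ := F.nonempty
    exact F.mem_of_superset Z hZ _ (zeroSet_mem 0) (fun x _ => by simp)
  add_mem' := by
    intro f g hf hg
    refine F.mem_of_superset _ (F.inter_mem _ hf _ hg) _ (zeroSet_mem (f + g)) ?_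
    rintro x ⟨h₁, h₂⟩
    have h₁ : f x = 0 := h₁
    have h₂ : g x = 0 := h₂
    simp [h₁, h₂]
  smul_mem' := by
    intro c f hf
    refine F.mem_of_superset _ hf _ (zeroSet_mem (c • f)) ?_
    intro x h
    have h : f x = 0 := h
    simp [h]

/-- A linear subspace of the commutative algebra `C₀(Ω, 𝕜)` is an ideal. -/
def IsIdeal (I : Submodule 𝕜 C₀(Ω, 𝕜)) : Prop :=
  ∀ f : C₀(Ω, 𝕜), ∀ g ∈ I, f * g ∈ I

/-- Prime ideals of `C₀(Ω, 𝕜)`; they are proper. -/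
def IsPrimeIdeal (I : Submodule 𝕜 C₀(Ω, 𝕜)) : Prop :=
  IsIdeal I ∧ I ≠ ⊤ ∧ ∀ f g : C₀(Ω, 𝕜), f * g ∈ I → f ∈ I ∨ g ∈ I

/-- `z`-ideals of `C₀(Ω, 𝕜)`: membership depends on the zero set only, monotonically. -/
def IsZIdeal (I : Submodule 𝕜 C₀(Ω, 𝕜)) : Prop :=
  IsIdeal I ∧ ∀ f ∈ I, ∀ g : C₀(Ω, 𝕜), {x | f x = 0} ⊆ {x | g x = 0} → g ∈ I

/-- The ideal `I` is supported at the point `p` of the one-point compactification: if `p` is a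
point of `Ω`, then `p` is the unique common zero of the functions in `I`; if `p` is the point at
infinity, then the functions in `I` have no common zero. -/
def IdealSupportedAt (I : Submodule 𝕜 C₀(Ω, 𝕜)) : OnePoint Ω → Prop
  | ∞ => ¬ ∃ q : Ω, ∀ f ∈ I, f q = 0
  | (p : Ω) => ∀ q : Ω, (∀ f ∈ I, f q = 0) ↔ q = p

end

end PrimeZ

/-!
If `p` has infinite Cantor–Bendixson rank, there are points `xₙ → p` of level `n` with disjoint
neighbourhoods `Vₙ`. By induction on the level, each `Vₙ` carries countable rank sets and a sequence
of open label sets such that every point of rank `m + 1` is a limit of points of rank `m` carrying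
any prescribed additional label. Choosing one label in each `Vₙ` along a sequence `lα : ℕ → ℕ`,
where the continuum many sequences `lα` are pairwise eventually different, gives cozero sets `Gα`.
Let `v` be an ultrafilter on points of growing rank that avoid every `Gα`. By the limit property,
`v` deforms, for each `α`, into an ultrafilter `uα` that contains `Gα` and the complements of all
other `Gβ`, and that contains every open member of `v`. If `v` is chosen with as few open members as
possible, then a closed set belonging to one `uα` belongs to all but finitely many of them.
-/

namespace PrimeZ

open scoped Cardinal

section Ultrafilters

variable {X ι : Type*} {L f : Filter X} {G : ι → Set X} {A : Set ι} {s U : Set X}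

/-- The filter generated by `L` and the complements of the sets `G β` with `β ∈ A`. The sets `A` of
interest are the set of all labels and the set of all labels but one. -/
def avoiding (L : Filter X) (G : ι → Set X) (A : Set ι) : Filter X :=
  L ⊓ ⨅ β ∈ A, 𝓟 (G β)ᶜ

theorem mem_avoiding : s ∈ avoiding L G A ↔
    ∃ F : Finset ι, ↑F ⊆ A ∧ ∀ᶠ x in L, x ∉ ⋃ β ∈ F, G β → x ∈ s := by
  rw [avoiding, mem_inf_iff_superset]
  constructor
  · rintro ⟨t, ht, c, hc, hs⟩
    obtain ⟨I, hI, hIA, hIc⟩ := mem_biInf_principal.1 hc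
    refine ⟨hI.toFinset, by simpa [subset_def] using hIA,
      mem_of_superset ht fun x hx hxI => hs ⟨hx, hIc ?_⟩⟩
    simpa using hxI
  · rintro ⟨F, hF, hs⟩
    refine ⟨_, hs, _, mem_biInf_principal.2 ⟨F, F.finite_toSet, hF, subset_rfl⟩,
      fun x hx => hx.1 ?_⟩
    simpa using hx.2

theorem compl_mem_avoiding {β : ι} (hβ : β ∈ A) : (G β)ᶜ ∈ avoiding L G A :=
  mem_inf_of_right (mem_biInf_principal.2 ⟨{β}, finite_singleton β, by simpa, by simp⟩)

variable [TopologicalSpace X]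

/-- A filter has a basis of open sets, stated through interiors. The neighbourhood filter of a
point, and its trace on a subspace, are the main examples. -/
def HasOpenBasis (f : Filter X) : Prop :=
  ∀ s ∈ f, interior s ∈ f

theorem HasOpenBasis.inf_principal (hf : HasOpenBasis f) (hU : IsOpen U) :
    HasOpenBasis (f ⊓ 𝓟 U) := by
  intro s hs
  rw [mem_inf_principal] at hs ⊢
  refine mem_of_superset (hf _ hs) fun x hx hxU => ?_
  exact interior_maximal (fun y hy => (interior_subset hy.1 : y ∈ U → y ∈ s) hy.2)
    (isOpen_interior.inter hU) ⟨hx, hxU⟩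

-- `f.bind 𝓝` is the filter generated by the open members of `f`.
theorem mem_bind_nhds : s ∈ f.bind 𝓝 ↔ interior s ∈ f := by
  rw [mem_bind', interior_eq_nhds']

theorem exists_minimal_hasOpenBasis (B : Filter X) [B.NeBot] :
    ∃ W : Filter X, Minimal (fun W => HasOpenBasis W ∧ (B ⊓ W).NeBot) W := by
  have hchain (c : Set (Filter X)) (hc : ∀ W ∈ c, HasOpenBasis W ∧ (B ⊓ W).NeBot)
      (hcc : IsChain (· ≥ ·) c) (hne : c.Nonempty) :
      HasOpenBasis (sInf c) ∧ (B ⊓ sInf c).NeBot := by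
    have hmem {s : Set X} : s ∈ sInf c ↔ ∃ V ∈ c, s ∈ V := by
      rw [sInf_eq_iInf, mem_biInf_of_directed hcc.directedOn hne]
    refine ⟨fun s hs => ?_, inf_neBot_iff.2 fun b hb s hs => ?_⟩ <;>
      obtain ⟨V, hV, hsV⟩ := hmem.1 hs
    · exact hmem.2 ⟨V, hV, (hc V hV).1 s hsV⟩
    · exact inf_neBot_iff.1 (hc V hV).2 hb hsV
  have htop : HasOpenBasis (⊤ : Filter X) := fun s hs => by simp_all
  obtain ⟨W, -, hW⟩ := zorn_le_nonempty₀ (α := (Filter X)ᵒᵈ) _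
    (fun c hc hcc W hW => ⟨_, hchain c hc hcc ⟨W, hW⟩, fun _ => sInf_le (α := Filter X)⟩)
    (⊤ : Filter X) ⟨htop, by simpa⟩
  exact ⟨W, hW.prop, fun V hV hVW => hW.le_of_ge hV hVW⟩

theorem exists_ultrafilter_le_forall_isClosed (B : Filter X) [B.NeBot] :
    ∃ v : Ultrafilter X, ↑v ≤ B ∧ ∀ Z ∈ v, IsClosed Z → Z ∈ B ⊓ (v : Filter X).bind 𝓝 := by
  obtain ⟨W, ⟨hW, hBW⟩, hmin⟩ := exists_minimal_hasOpenBasis B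
  obtain ⟨hvB, hvW⟩ := le_inf_iff.1 (Ultrafilter.of_le (B ⊓ W))
  set v := Ultrafilter.of (B ⊓ W)
  have hbind : (v : Filter X).bind 𝓝 ≤ W := fun s hs => mem_bind_nhds.2 (hvW (hW s hs))
  refine ⟨v, hvB, fun Z hZv hZ => inf_le_inf_left B hbind ?_⟩
  by_contra hZW
  have hne : (B ⊓ (W ⊓ 𝓟 Zᶜ)).NeBot := by
    rwa [← inf_assoc, neBot_iff, ne_eq, ← mem_iff_inf_principal_compl]
  have hZc : Zᶜ ∈ W :=
    le_principal_iff.1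
      ((hmin ⟨hW.inf_principal hZ.isOpen_compl, hne⟩ inf_le_left).trans inf_le_right)
  exact Ultrafilter.compl_mem_iff_notMem.1 (hvW hZc) hZv

theorem neBot_inf_bind_nhds {v : Filter X} [v.NeBot] (h : ∀ s ∈ f, closure s ∈ v) :
    (f ⊓ v.bind 𝓝).NeBot := by
  refine inf_neBot_iff.2 fun s hs V hV => ?_
  obtain ⟨x, hxs, hxV⟩ := Filter.nonempty_of_mem (inter_mem (h s hs) (mem_bind_nhds.1 hV))
  exact (mem_closure_iff.1 hxs _ isOpen_interior hxV).imp
    fun y hy => ⟨hy.2, interior_subset hy.1⟩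

theorem exists_ultrafilters_finite_notMem [(avoiding L G univ).NeBot]
    (hcl : ∀ α, ∀ s ∈ avoiding L G {α}ᶜ ⊓ 𝓟 (G α), closure s ∈ avoiding L G univ) :
    ∃ u : ι → Ultrafilter X, (∀ α, ↑(u α) ≤ avoiding L G {α}ᶜ) ∧ (∀ α, G α ∈ u α) ∧
      ∀ Z, IsClosed Z → ∀ α, Z ∈ u α → {β | Z ∉ u β}.Finite := by
  obtain ⟨v, hvB, hv⟩ := exists_ultrafilter_le_forall_isClosed (avoiding L G univ)
  have hne α : (avoiding L G {α}ᶜ ⊓ 𝓟 (G α) ⊓ (v : Filter X).bind 𝓝).NeBot :=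
    neBot_inf_bind_nhds fun s hs => hvB (hcl α s hs)
  choose huA huv using fun α => le_inf_iff.1
    (Ultrafilter.of_le (avoiding L G {α}ᶜ ⊓ 𝓟 (G α) ⊓ (v : Filter X).bind 𝓝))
  choose huA huG using fun α => le_inf_iff.1 (huA α)
  refine ⟨_, huA, fun α => le_principal_iff.1 (huG α), fun Z hZ α hZα => ?_⟩
  have hZv : Z ∈ v := by
    by_contra hZv
    have hZc : Zᶜ ∈ (v : Filter X).bind 𝓝 := by
      rw [mem_bind_nhds, hZ.isOpen_compl.interior_eq]
      exact Ultrafilter.compl_mem_iff_notMem.2 hZv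
    exact Ultrafilter.compl_mem_iff_notMem.1 (huv α hZc) hZα
  obtain ⟨b, hb, V, hV, hbV⟩ := mem_inf_iff_superset.1 (hv Z hZv hZ)
  obtain ⟨F, -, hF⟩ := mem_avoiding.1 hb
  refine F.finite_toSet.subset fun β hβ => by_contra fun hβF => hβ ?_
  have hbβ : b ∈ avoiding L G {β}ᶜ := mem_avoiding.2 ⟨F, subset_compl_singleton_iff.2 hβF, hF⟩
  exact mem_of_superset (inter_mem (huA β hbβ) (huv β hV)) hbV

end Ultrafilters

section C0Cozero

variable {X : Type*} [TopologicalSpace X] {U : Set X}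

/-- Cozero sets of functions vanishing at infinity. Real functions suffice, since a scalar function
and its norm have the same zeros. -/
def IsC0Cozero (U : Set X) : Prop :=
  ∃ f : C₀(X, ℝ), Function.support f = U

theorem isC0Cozero_empty : IsC0Cozero (∅ : Set X) :=
  ⟨0, by simp⟩

theorem IsC0Cozero.isOpen (hU : IsC0Cozero U) : IsOpen U := by
  obtain ⟨f, rfl⟩ := hU
  exact (map_continuous f).isOpen_support

theorem IsC0Cozero.iUnion {U : ℕ → Set X} (hU : ∀ n, IsC0Cozero (U n)) :
    IsC0Cozero (⋃ n, U n) := by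
  choose f hf using hU
  let g (n : ℕ) (x : X) : ℝ := min |f n x| ((1 / 2) ^ n)
  have hg_nonneg n x : 0 ≤ g n x := le_min (abs_nonneg _) (by positivity)
  have hg_le n x : ‖g n x‖ ≤ (1 / 2) ^ n := by
    rw [Real.norm_of_nonneg (hg_nonneg n x)]
    exact min_le_right _ _
  have hg_cont n : Continuous (g n) := by fun_prop
  have hg_zero n : Tendsto (g n) (cocompact X) (𝓝 0) :=
    squeeze_zero (hg_nonneg n) (fun x => min_le_left _ _) (by simpa using (zero_at_infty (f n)).abs)
  refine ⟨⟨⟨fun x => ∑' n, g n x, continuous_tsum hg_cont summable_geometric_two hg_le⟩, ?_⟩, ?_⟩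
  · simpa only [tsum_zero] using tendsto_tsum_of_dominated_convergence summable_geometric_two
      hg_zero (Eventually.of_forall fun x n => hg_le n x)
  · ext x
    have hsum : Summable fun n => g n x :=
      .of_norm_bounded summable_geometric_two fun n => hg_le n x
    have hgf n : g n x = 0 ↔ x ∉ U n := by
      have : (0 : ℝ) < (1 / 2) ^ n := by positivity
      rw [← hf, Function.notMem_support, ← abs_eq_zero]
      grind
    rw [mem_iUnion, ← not_iff_not, Function.notMem_support, not_exists]
    change ∑' n, g n x = 0 ↔ _
    rw [← hsum.hasSum_iff, hasSum_zero_iff_of_nonneg fun n => hg_nonneg n x]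
    exact funext_iff.trans (forall_congr' hgf)

theorem exists_isC0Cozero_subset [LocallyCompactSpace X] [T2Space X] {x : X} (hU : U ∈ 𝓝 x) :
    ∃ V ⊆ U, IsC0Cozero V ∧ x ∈ V := by
  obtain ⟨f, hfx, hf0, hfc, -⟩ := exists_continuous_one_zero_of_isCompact
    (isCompact_singleton (x := x)) isOpen_interior.isClosed_compl
    (disjoint_singleton_left.2 fun h => h (mem_interior_iff_mem_nhds.2 hU))
  refine ⟨Function.support f, fun y hy => ?_, ⟨⟨f, hfc.is_zero_at_infty⟩, rfl⟩, ?_⟩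
  · exact interior_subset (not_not.1 fun h => hy (hf0 h))
  · simp [hfx rfl]

theorem IsC0Cozero.exists_c0_eq_zero_iff (𝕜 : Type*) [RCLike 𝕜] (hU : IsC0Cozero U) :
    ∃ f : C₀(X, 𝕜), ∀ x, f x = 0 ↔ x ∉ U := by
  obtain ⟨f, rfl⟩ := hU
  refine ⟨⟨⟨fun x => (f x : 𝕜), by fun_prop⟩, ?_⟩, fun x => ?_⟩
  · simpa [Function.comp_def] using
      ((RCLike.continuous_ofReal (K := 𝕜)).tendsto 0).comp (zero_at_infty f)
  · exact RCLike.ofReal_eq_zero.trans Function.notMem_support.symm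

end C0Cozero

section Sequences

variable {X : Type*} [TopologicalSpace X]

theorem exists_seq_tendsto_of_accPt [FirstCountableTopology X] {q : X} {E : ℕ → Set X}
    (h : ∀ n, AccPt q (𝓟 (E n))) :
    ∃ x : ℕ → X, (∀ n, x n ∈ E n) ∧ (∀ n, x n ≠ q) ∧ Tendsto x atTop (𝓝 q) := by
  obtain ⟨b, hb⟩ := (𝓝 q).exists_antitone_basis
  choose x hx hxq using fun n => accPt_iff_nhds.1 (h n) (b n) (hb.mem n)
  exact ⟨x, fun n => (hx n).2, hxq, hb.tendsto fun n => (hx n).1⟩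

theorem exists_subseq_disjoint_open [T2Space X] {p : X} {x : ℕ → X}
    (hx : Tendsto x atTop (𝓝 p)) (hne : ∀ n, x n ≠ p) :
    ∃ φ : ℕ → ℕ, StrictMono φ ∧ ∃ U : ℕ → Set X, (∀ n, IsOpen (U n)) ∧ (∀ n, x (φ n) ∈ U n) ∧
      (∀ n, p ∉ U n) ∧ Pairwise (Function.onFun Disjoint U) := by
  choose A B hA hB hxA hpB hAB using fun n => t2_separation (hne n)
  have hev m : ∃ N, m < N ∧ ∀ n ≥ N, x n ∈ B m := by
    obtain ⟨N, hN⟩ := eventually_atTop.1 (hx.eventually_mem ((hB m).mem_nhds (hpB m)))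
    exact ⟨max N (m + 1), by lia, fun n hn => hN n (by lia)⟩
  choose g hg hgB using hev
  let φ (n : ℕ) : ℕ := g^[n] 0
  have hφg n : φ (n + 1) = g (φ n) := Function.iterate_succ_apply' g n 0
  have hφ : StrictMono φ := strictMono_nat_of_lt_succ fun n => hφg n ▸ hg _
  have hxB i j (hij : i < j) : x (φ j) ∈ B (φ i) := hgB _ _ (hφg i ▸ hφ.monotone hij)
  refine ⟨φ, hφ, fun n => A (φ n) ∩ ⋂ i ∈ Iio n, B (φ i), fun n => ?_, fun n => ?_, fun n h => ?_,
    (pairwise_disjoint_on _).2 fun m n hmn => ?_⟩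
  · exact (hA _).inter ((finite_Iio n).isOpen_biInter fun i _ => hB _)
  · exact ⟨hxA _, mem_iInter₂.2 fun i hi => hxB i n hi⟩
  · exact disjoint_left.1 (hAB _) h.1 (hpB _)
  · exact (hAB _).mono inter_subset_left fun z hz => mem_iInter₂.1 hz.2 m hmn

theorem exists_seq_disjoint_isC0Cozero_of_accPt [LocallyCompactSpace X] [T2Space X]
    [FirstCountableTopology X] {x : X} {E U : Set X} (hx : AccPt x (𝓟 E)) (hU : U ∈ 𝓝 x) :
    ∃ (y : ℕ → X) (W : ℕ → Set X), (∀ a, y a ∈ E) ∧ Tendsto y atTop (𝓝 x) ∧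
      (∀ a, IsC0Cozero (W a)) ∧ (∀ a, y a ∈ W a) ∧ (∀ a, W a ⊆ U \ {x}) ∧
      Pairwise (Function.onFun Disjoint W) := by
  obtain ⟨y, hy, hyx, hyt⟩ :=
    exists_seq_tendsto_of_accPt fun _ : ℕ => hx.nhds_inter (interior_mem_nhds.2 hU)
  obtain ⟨φ, hφ, V, hVo, hyV, hxV, hV⟩ := exists_subseq_disjoint_open hyt hyx
  choose W hWVU hW hyW using fun a => exists_isC0Cozero_subset
    (inter_mem ((hVo a).mem_nhds (hyV a)) (mem_interior_iff_mem_nhds.1 (hy (φ a)).1))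
  refine ⟨y ∘ φ, W, fun a => (hy _).2, hyt.comp hφ.tendsto_atTop, hW, hyW, fun a z hz => ?_,
    fun a c hac => (hV hac).mono (fun z hz => (hWVU a hz).1) fun z hz => (hWVU c hz).1⟩
  exact ⟨(hWVU a hz).2, fun hzx => hxV a (hzx ▸ (hWVU a hz).1)⟩

end Sequences

section LabelledRank

variable {X κ : Type*} [TopologicalSpace X]

theorem mem_iUnion_iff_of_mem {Y : Type*} {W S : κ → Set Y} {a : κ} {z : Y}
    (hW : Pairwise (Function.onFun Disjoint W)) (hS : ∀ c, S c ⊆ W c) (hz : z ∈ W a) :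
    z ∈ ⋃ c, S c ↔ z ∈ S a := by
  refine ⟨fun h => ?_, fun h => mem_iUnion_of_mem a h⟩
  obtain ⟨c, hc⟩ := mem_iUnion.1 h
  rwa [hW.eq (not_disjoint_iff.2 ⟨z, hz, hS c hc⟩)]

/-- A rank structure on `U`: the decreasing sets `T m` are the points of rank at least `m`, and the
cozero set `G i` is the set of points carrying the label `i`, where a point may carry several
labels. For every label `i`, each point `y` of rank at least `m + 1` is a limit of points of rank
at least `m` which carry `i` and otherwise only labels of `y`. -/
structure LabelledRank (U : Set X) (T : ℕ → Set X) (G : κ → Set X) : Prop where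
  antitone : Antitone T
  countable : (T 0).Countable
  isC0Cozero : ∀ i, IsC0Cozero (G i)
  rank_subset : ∀ m, T m ⊆ U
  label_subset : ∀ i, G i ⊆ U
  mem_closure : ∀ m i, ∀ y ∈ T (m + 1),
    y ∈ closure {z | z ∈ T m ∧ z ∈ G i ∧ ∀ j ≠ i, z ∈ G j → y ∈ G j}

namespace LabelledRank

variable {U W : Set X} {T : ℕ → Set X} {G : κ → Set X}

theorem empty (U : Set X) : LabelledRank U (fun _ => ∅) (fun _ : κ => ∅) where
  antitone := antitone_const
  countable := countable_empty
  isC0Cozero _ := isC0Cozero_empty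
  rank_subset _ := empty_subset U
  label_subset _ := empty_subset U
  mem_closure := by simp

theorem mono (h : LabelledRank U T G) (hUW : U ⊆ W) : LabelledRank W T G :=
  { h with
    rank_subset := fun m => (h.rank_subset m).trans hUW
    label_subset := fun i => (h.label_subset i).trans hUW }

theorem update [DecidableEq κ] (h : LabelledRank U T G) (hU : IsC0Cozero U) (k : κ) :
    LabelledRank U T (Function.update G k U) where
  antitone := h.antitone
  countable := h.countable
  isC0Cozero := Function.forall_update_iff _ _ |>.2 ⟨hU, fun i _ => h.isC0Cozero i⟩
  rank_subset := h.rank_subset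
  label_subset := Function.forall_update_iff _ (fun _ s => s ⊆ U) |>.2
    ⟨subset_rfl, fun i _ => h.label_subset i⟩
  mem_closure m i y hy := by
    have hyU := h.rank_subset _ hy
    refine closure_mono ?_ (h.mem_closure m i y hy)
    rintro z ⟨hzT, hzi, hz⟩
    have hzU := h.rank_subset _ hzT
    exact ⟨hzT, by grind [Function.update_apply], by grind [Function.update_apply]⟩

theorem iUnion {W : ℕ → Set X} {T : ℕ → ℕ → Set X} {G : ℕ → κ → Set X}
    (h : ∀ a, LabelledRank (W a) (T a) (G a)) (hW : Pairwise (Function.onFun Disjoint W)) :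
    LabelledRank (⋃ a, W a) (fun m => ⋃ a, T a m) (fun i => ⋃ a, G a i) where
  antitone _ _ hmn := iUnion_mono fun a => (h a).antitone hmn
  countable := countable_iUnion fun a => (h a).countable
  isC0Cozero i := .iUnion fun a => (h a).isC0Cozero i
  rank_subset m := iUnion_mono fun a => (h a).rank_subset m
  label_subset i := iUnion_mono fun a => (h a).label_subset i
  mem_closure m i y hy := by
    obtain ⟨a, hya⟩ := mem_iUnion.1 hy
    have hG {j z} (hz : z ∈ W a) : z ∈ ⋃ c, G c j ↔ z ∈ G a j :=
      mem_iUnion_iff_of_mem hW (fun c => (h c).label_subset j) hz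
    have hyW := (h a).rank_subset _ hya
    refine closure_mono ?_ ((h a).mem_closure m i y hya)
    rintro z ⟨hzT, hzi, hz⟩
    have hzW := (h a).rank_subset _ hzT
    exact ⟨mem_iUnion_of_mem a hzT, (hG hzW).2 hzi, fun j hj hzj =>
      (hG hyW).2 (hz j hj ((hG hzW).1 hzj))⟩

theorem union_singleton {x : X} {n : ℕ} (h : LabelledRank U T G) (hxU : x ∈ U)
    (hx : ∀ k < n, ∀ i, x ∈ closure {z | z ∈ T k ∧ ∀ j, z ∈ G j ↔ j = i}) :
    LabelledRank U (fun m => T m ∪ {z | m ≤ n ∧ z = x}) G where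
  antitone m k hmk := union_subset_union (h.antitone hmk) fun z hz => ⟨hmk.trans hz.1, hz.2⟩
  countable := h.countable.union ((countable_singleton x).mono fun z hz => hz.2)
  isC0Cozero := h.isC0Cozero
  rank_subset m := union_subset (h.rank_subset m) fun z hz => hz.2.symm ▸ hxU
  label_subset := h.label_subset
  mem_closure m i := by
    rintro y (hy | ⟨hm, rfl⟩)
    · exact closure_mono (fun z hz => hz.imp_left Or.inl) (h.mem_closure m i y hy)
    · refine closure_mono ?_ (hx m hm i)
      rintro z ⟨hzT, hz⟩
      exact ⟨.inl hzT, (hz i).2 rfl, fun j hj hzj => absurd ((hz j).1 hzj) hj⟩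

end LabelledRank

theorem exists_labelledRank [LocallyCompactSpace X] [T2Space X] [FirstCountableTopology X]
    {E : ℕ → Set X} (hE : ∀ n, ∀ x ∈ E (n + 1), AccPt x (𝓟 (E n))) (n : ℕ) {x : X}
    (hx : x ∈ E n) {U : Set X} (hU : U ∈ 𝓝 x) :
    ∃ T G : ℕ → Set X, LabelledRank U T G ∧ x ∈ T n ∧ ∀ i, x ∉ G i := by
  induction n generalizing x U with
  | zero =>
    exact ⟨_, _, (LabelledRank.empty U).union_singleton (n := 0) (mem_of_mem_nhds hU) (by simp),
      by simp, by simp⟩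
  | succ n ih =>
    obtain ⟨y, W, hyE, hyx, hWc, hyW, hWU, hW⟩ :=
      exists_seq_disjoint_isC0Cozero_of_accPt (hE n x hx) hU
    choose T G hTG hyT hyG using fun a => ih (hyE a) ((hWc a).isOpen.mem_nhds (hyW a))
    -- the point `y a` receives the label `a.unpair.1`, so each label is used infinitely often
    let G' (a : ℕ) := Function.update (G a) a.unpair.1 (W a)
    have hTG' a : LabelledRank (W a) (T a) (G' a) := (hTG a).update (hWc a) _
    have hyG' a j : y a ∈ ⋃ c, G' c j ↔ j = a.unpair.1 := by
      rw [mem_iUnion_iff_of_mem hW (fun c => (hTG' c).label_subset j) (hyW a)]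
      grind [Function.update_apply]
    have hxcl : ∀ k < n + 1, ∀ i,
        x ∈ closure {z | z ∈ ⋃ a, T a k ∧ ∀ j, z ∈ ⋃ a, G' a j ↔ j = i} := fun k hk i =>
      mem_closure_of_tendsto
        (hyx.comp (tendsto_atTop_mono (Nat.right_le_pair i) tendsto_id))
        (Eventually.of_forall fun N =>
          ⟨mem_iUnion_of_mem _ ((hTG _).antitone (Nat.le_of_lt_succ hk) (hyT _)), by simp [hyG']⟩)
    refine ⟨_, _, ((LabelledRank.iUnion hTG' hW).mono ?_).union_singleton (mem_of_mem_nhds hU) hxcl,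
      .inr ⟨le_rfl, rfl⟩, fun i hxi => ?_⟩
    · exact iUnion_subset fun a => (hWU a).trans sdiff_subset
    · obtain ⟨a, ha⟩ := mem_iUnion.1 hxi
      exact (hWU a ((hTG' a).label_subset i ha)).2 rfl

end LabelledRank

section Gluing

variable {X ι : Type*}

theorem exists_eventually_different (hι : #ι ≤ 𝔠) :
    ∃ l : ι → ℕ → ℕ, Pairwise fun α β => ∀ᶠ n in atTop, l α n ≠ l β n := by
  have hcard : Cardinal.lift.{0} #ι ≤ Cardinal.lift #(ℕ → Bool) := by simpa using hι
  obtain ⟨e⟩ := Cardinal.lift_mk_le'.1 hcard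
  refine ⟨fun α n => Encodable.encode (List.ofFn fun i : Fin n => e α i), fun α β hαβ => ?_⟩
  obtain ⟨i, hi⟩ := Function.ne_iff.1 (e.injective.ne hαβ)
  filter_upwards [eventually_gt_atTop i] with n hn h
  exact hi (congrFun (List.ofFn_injective (Encodable.encode_injective h)) ⟨i, hn⟩)

/-- The points of rank at least `m` in one of the rank structures with index at least `m`. -/
def rankTail (T : ℕ → ℕ → Set X) (m : ℕ) : Set X :=
  ⋃ n ≥ m, T n m

/-- The points carrying the label `l n` in the `n`-th rank structure, for some `n`. -/
def labelUnion {κ : Type*} (G : ℕ → κ → Set X) (l : ℕ → κ) : Set X :=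
  ⋃ n, G n (l n)

theorem mem_rankTail {T : ℕ → ℕ → Set X} {m : ℕ} {x : X} :
    x ∈ rankTail T m ↔ ∃ n ≥ m, x ∈ T n m := by
  simp [rankTail]

variable [TopologicalSpace X] {κ : Type*} {V : ℕ → Set X} {T : ℕ → ℕ → Set X} {G : ℕ → κ → Set X}

theorem antitone_rankTail (h : ∀ n, LabelledRank (V n) (T n) (G n)) : Antitone (rankTail T) := by
  intro m k hmk x hx
  obtain ⟨n, hn, hxn⟩ := mem_rankTail.1 hx
  exact mem_rankTail.2 ⟨n, hmk.trans hn, (h n).antitone hmk hxn⟩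

theorem countable_rankTail_zero (h : ∀ n, LabelledRank (V n) (T n) (G n)) :
    (rankTail T 0).Countable :=
  (countable_iUnion fun n => (h n).countable).mono
    (iUnion₂_subset fun n _ => subset_iUnion (fun n => T n 0) n)

theorem isC0Cozero_labelUnion (h : ∀ n, LabelledRank (V n) (T n) (G n)) (l : ℕ → κ) :
    IsC0Cozero (labelUnion G l) :=
  .iUnion fun n => (h n).isC0Cozero (l n)

theorem mem_labelUnion_iff (h : ∀ n, LabelledRank (V n) (T n) (G n))
    (hV : Pairwise (Function.onFun Disjoint V)) {l : ℕ → κ} {n : ℕ} {x : X} (hx : x ∈ V n) :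
    x ∈ labelUnion G l ↔ x ∈ G n (l n) :=
  mem_iUnion_iff_of_mem hV (fun k => (h k).label_subset (l k)) hx

theorem exists_rankTail_sdiff_subset_closure (h : ∀ n, LabelledRank (V n) (T n) (G n))
    (hV : Pairwise (Function.onFun Disjoint V)) {l : ι → ℕ → κ} {α : ι} {F : Finset ι}
    (hl : ∀ β ∈ F, ∀ᶠ n in atTop, l β n ≠ l α n) (m : ℕ) :
    ∃ M, rankTail T M \ ⋃ β ∈ F, labelUnion G (l β) ⊆
      closure ((rankTail T m \ ⋃ β ∈ F, labelUnion G (l β)) ∩ labelUnion G (l α)) := by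
  obtain ⟨K, hK⟩ := eventually_atTop.1 ((Finset.eventually_all F).2 hl)
  refine ⟨max K (m + 1), fun y ⟨hyT, hyF⟩ => ?_⟩
  obtain ⟨n, hn, hyT⟩ := mem_rankTail.1 hyT
  have hyT : y ∈ T n (m + 1) := (h n).antitone (le_max_right _ _) hyT
  have hyV := (h n).rank_subset _ hyT
  refine closure_mono ?_ ((h n).mem_closure m (l α n) y hyT)
  rintro z ⟨hzT, hzα, hz⟩
  have hzV := (h n).rank_subset _ hzT
  refine ⟨⟨mem_rankTail.2 ⟨n, by lia, hzT⟩, fun hzF => hyF ?_⟩, (mem_labelUnion_iff h hV hzV).2 hzα⟩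
  simp only [mem_iUnion, mem_labelUnion_iff h hV hzV, mem_labelUnion_iff h hV hyV] at hzF ⊢
  obtain ⟨β, hβ, hzβ⟩ := hzF
  exact ⟨β, hβ, hz _ (hK n (by lia) β hβ) hzβ⟩

end Gluing

section RankFilter

variable {X ι : Type*} {N : Filter X} {R : ℕ → Set X} {G : ι → Set X}

theorem mem_inf_iInf_principal_of_antitone (hR : Antitone R) {s : Set X} :
    s ∈ N ⊓ ⨅ m, 𝓟 (R m) ↔ ∃ m, ∀ᶠ x in N, x ∈ R m → x ∈ s := by
  have hdir : Directed (· ≥ ·) fun m => N ⊓ 𝓟 (R m) :=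
    Antitone.directed_ge fun m k hmk => inf_le_inf_left N (principal_mono.2 (hR hmk))
  rw [inf_iInf, mem_iInf_of_directed hdir]
  simp only [mem_inf_principal, Filter.Eventually]

theorem neBot_avoiding_univ (hR : Antitone R) {x : ℕ → X} (hx : Tendsto x atTop N)
    (hxR : ∀ n, x n ∈ R n) (hxG : ∀ n α, x n ∉ G α) :
    (avoiding (N ⊓ ⨅ m, 𝓟 (R m)) G univ).NeBot := by
  suffices h : Tendsto x atTop (avoiding (N ⊓ ⨅ m, 𝓟 (R m)) G univ) from map_neBot.mono h
  refine tendsto_inf.2 ⟨tendsto_inf.2 ⟨hx, tendsto_iInf.2 fun m => tendsto_principal.2 ?_⟩, ?_⟩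
  · filter_upwards [eventually_ge_atTop m] with n hn using hR hn (hxR n)
  · exact tendsto_iInf.2 fun α => tendsto_iInf.2 fun _ => tendsto_principal.2 <|
      .of_forall fun n => hxG n α

theorem closure_mem_avoiding_univ [TopologicalSpace X] (hN : HasOpenBasis N) (hR : Antitone R)
    {α : ι} (hcl : ∀ (F : Finset ι) (m : ℕ), α ∉ F → ∃ M,
      R M \ ⋃ β ∈ F, G β ⊆ closure ((R m \ ⋃ β ∈ F, G β) ∩ G α))
    {s : Set X} (hs : s ∈ avoiding (N ⊓ ⨅ m, 𝓟 (R m)) G {α}ᶜ ⊓ 𝓟 (G α)) :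
    closure s ∈ avoiding (N ⊓ ⨅ m, 𝓟 (R m)) G univ := by
  obtain ⟨F, hFα, hF⟩ := mem_avoiding.1 (mem_inf_principal.1 hs)
  obtain ⟨m, hm⟩ := (mem_inf_iInf_principal_of_antitone hR).1 hF
  obtain ⟨M, hM⟩ := hcl F m (subset_compl_singleton_iff.1 hFα)
  refine mem_avoiding.2 ⟨F, subset_univ _, (mem_inf_iInf_principal_of_antitone hR).2 ⟨M, ?_⟩⟩
  filter_upwards [hN _ hm] with x hxo hxM hxF
  refine closure_mono ?_ (isOpen_interior.inter_closure ⟨hxo, hM ⟨hxM, hxF⟩⟩)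
  exact fun y ⟨hyo, ⟨hyR, hyF⟩, hyα⟩ => interior_subset hyo hyR hyF hyα

theorem exists_filter_isC0Cozero_family [TopologicalSpace X] [LocallyCompactSpace X] [T2Space X]
    [FirstCountableTopology X] (hN : HasOpenBasis N) {E : ℕ → Set X}
    (hE : ∀ n, ∀ x ∈ E (n + 1), AccPt x (𝓟 (E n))) {x : ℕ → X} (hxE : ∀ n, x n ∈ E n)
    {V : ℕ → Set X} (hxV : ∀ n, V n ∈ 𝓝 (x n)) (hV : Pairwise (Function.onFun Disjoint V))
    (hx : Tendsto x atTop N) (hι : #ι ≤ 𝔠) :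
    ∃ L ≤ N, ∃ G : ι → Set X, (∃ S ∈ L, S.Countable) ∧ (∀ α, IsC0Cozero (G α)) ∧
      (avoiding L G univ).NeBot ∧
      ∀ α, ∀ s ∈ avoiding L G {α}ᶜ ⊓ 𝓟 (G α), closure s ∈ avoiding L G univ := by
  obtain ⟨l, hl⟩ := exists_eventually_different hι
  choose T G h hxT hxG using fun n => exists_labelledRank hE n (hxE n) (hxV n)
  have hR := antitone_rankTail h
  refine ⟨N ⊓ ⨅ m, 𝓟 (rankTail T m), inf_le_left, fun α => labelUnion G (l α),
    ⟨rankTail T 0, mem_inf_of_right (mem_iInf_of_mem 0 (mem_principal_self _)),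
      countable_rankTail_zero h⟩, fun α => isC0Cozero_labelUnion h (l α),
    neBot_avoiding_univ hR hx (fun n => mem_rankTail.2 ⟨n, le_rfl, hxT n⟩) fun n α hxα => ?_,
    fun α s => closure_mem_avoiding_univ hN hR fun F m hα => ?_⟩
  · exact hxG n _ ((mem_labelUnion_iff h hV (mem_of_mem_nhds (hxV n))).1 hxα)
  · exact exists_rankTail_sdiff_subset_closure h hV
      (fun β hβ => hl (ne_of_mem_of_not_mem hβ hα)) m

end RankFilter

section Levels

variable {X : Type*} [TopologicalSpace X]

theorem antitone_cbLevel : Antitone (cbLevel X) :=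
  antitone_nat_of_succ_le fun n => (cbLevel_succ X n).trans_subset relDerivedSet_subset

theorem isClosed_cbLevel (n : ℕ) : IsClosed (cbLevel X n) :=
  CantorBendixson.isClosed_iteratedDerivedSet isClosed_univ _

theorem accPt_of_mem_cbLevel_succ {x : X} {n : ℕ} (hx : x ∈ cbLevel X (n + 1)) :
    AccPt x (𝓟 (cbLevel X n)) := by
  rw [cbLevel_succ] at hx
  exact hx.1

theorem accPt_preimage_coe {x : X} {C : Set (OnePoint X)} (h : AccPt (x : OnePoint X) (𝓟 C)) :
    AccPt x (𝓟 ((↑) ⁻¹' C)) := by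
  rw [← comap_principal]
  exact OnePoint.isOpenEmbedding_coe.isOpenMap.accPt_comap h

theorem not_isCompact_preimage_coe {C : Set (OnePoint X)} (hC : IsClosed C)
    (h : AccPt ∞ (𝓟 C)) : ¬ IsCompact (((↑) : X → OnePoint X) ⁻¹' C) := by
  intro hcomp
  have hCc : ((↑) ⁻¹' C : Set X)ᶜ ∈ coclosedCompact X :=
    hcomp.compl_mem_coclosedCompact_of_isClosed (hC.preimage OnePoint.continuous_coe)
  rw [AccPt, OnePoint.nhdsNE_infty_eq] at h
  obtain ⟨_, ⟨x, hx, rfl⟩, hxC⟩ := inf_neBot_iff.1 h (image_mem_map hCc) (mem_principal_self C)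
  exact hx hxC

end Levels

section Escape

variable {X : Type*} [TopologicalSpace X]

theorem exists_seq_tendsto_cocompact [TopologicalSpace.MetrizableSpace X] {E : Set X}
    (hE : IsClosed E) (hEc : ¬ IsCompact E) :
    ∃ x : ℕ → X, (∀ n, x n ∈ E) ∧ Tendsto x atTop (cocompact X) := by
  rw [isCompact_iff_isSeqCompact, IsSeqCompact] at hEc
  push Not at hEc
  obtain ⟨x, hxE, hx⟩ := hEc
  refine ⟨x, hxE, hasBasis_cocompact.tendsto_right_iff.2 fun C hC => not_frequently.1 fun hxC => ?_⟩
  obtain ⟨a, -, φ, hφ, hlim⟩ := hC.isSeqCompact.subseq_of_frequently_in hxC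
  exact hx a (hE.mem_of_tendsto hlim (.of_forall fun n => hxE _)) φ hφ hlim

theorem exists_seq_tendsto_cocompact_of_isCompact_iInter [LocallyCompactSpace X] {E : ℕ → Set X}
    (hE : ∀ n, IsClosed (E n)) (hanti : Antitone E) (hEc : ∀ n, ¬ IsCompact (E n))
    (hc : IsCompact (⋂ n, E n)) :
    ∃ x : ℕ → X, (∀ n, x n ∈ E n) ∧ Tendsto x atTop (cocompact X) := by
  obtain ⟨K, hK, hEK⟩ := exists_compact_superset hc
  choose x hxE hxK using fun n => not_subset.1 fun h => hEc n (hK.of_isClosed_subset (hE n) h)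
  refine ⟨x, hxE, hasBasis_cocompact.tendsto_right_iff.2 fun C hC => ?_⟩
  have hdisj : C \ interior K ∩ ⋂ n, E n = ∅ :=
    eq_empty_of_forall_notMem fun z hz => hz.1.2 (hEK hz.2)
  obtain ⟨n, hn⟩ := (hC.diff isOpen_interior).elim_directed_family_closed E hE hdisj
    hanti.directed_ge
  filter_upwards [eventually_ge_atTop n] with k hk hkC
  exact hn.subset ⟨⟨hkC, fun h => hxK k (interior_subset h)⟩, hanti hk (hxE k)⟩

theorem exists_seq_tendsto_cocompact_of_antitone [LocallyCompactSpace X]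
    [TopologicalSpace.MetrizableSpace X] {E : ℕ → Set X} (hE : ∀ n, IsClosed (E n))
    (hanti : Antitone E) (hEc : ∀ n, ¬ IsCompact (E n)) :
    ∃ x : ℕ → X, (∀ n, x n ∈ E n) ∧ Tendsto x atTop (cocompact X) := by
  by_cases hc : IsCompact (⋂ n, E n)
  · exact exists_seq_tendsto_cocompact_of_isCompact_iInter hE hanti hEc hc
  · obtain ⟨x, hxE, hx⟩ := exists_seq_tendsto_cocompact (isClosed_iInter hE) hc
    exact ⟨x, fun n => mem_iInter.1 (hxE n) n, hx⟩

theorem exists_seq_tendsto_of_mem_cbLevelInfty [LocallyCompactSpace X]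
    [TopologicalSpace.MetrizableSpace X] {p : OnePoint X} (hp : p ∈ cbLevelInfty (OnePoint X)) :
    ∃ x : ℕ → X, (∀ n, (x n : OnePoint X) ∈ cbLevel (OnePoint X) n) ∧
      (∀ n, (x n : OnePoint X) ≠ p) ∧ Tendsto (fun n => (x n : OnePoint X)) atTop (𝓝 p) := by
  have hacc n : AccPt p (𝓟 (cbLevel (OnePoint X) n)) :=
    accPt_of_mem_cbLevel_succ (mem_iInter.1 hp (n + 1))
  induction p using OnePoint.rec with
  | coe p =>
    obtain ⟨x, hxl, hxp, hx⟩ := exists_seq_tendsto_of_accPt fun n => accPt_preimage_coe (hacc n)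
    exact ⟨x, hxl, fun n => OnePoint.coe_injective.ne (hxp n),
      (OnePoint.continuous_coe.tendsto p).comp hx⟩
  | infty =>
    obtain ⟨x, hxl, hx⟩ := exists_seq_tendsto_cocompact_of_antitone
      (fun n => (isClosed_cbLevel n).preimage OnePoint.continuous_coe)
      (fun m n hmn => preimage_mono (antitone_cbLevel hmn))
      fun n => not_isCompact_preimage_coe (isClosed_cbLevel n) (hacc n)
    rw [← coclosedCompact_eq_cocompact] at hx
    exact ⟨x, hxl, fun n => OnePoint.coe_ne_infty _, OnePoint.tendsto_coe_infty.comp hx⟩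

end Escape

section ZFilters

variable {𝕜 : Type*} [RCLike 𝕜] {X ι : Type*} [TopologicalSpace X]

theorem isClosed_of_mem_zeroSets {Z : Set X} (hZ : Z ∈ zeroSets 𝕜 X) : IsClosed Z := by
  obtain ⟨f, rfl⟩ := hZ
  exact isClosed_singleton.preimage f.continuous

theorem isIdeal_c0Ideal (F : ZFilter 𝕜 X) : IsIdeal F.c0Ideal := fun f g hg =>
  F.mem_of_superset _ hg _ (zeroSet_mem (f * g)) fun x (hx : g x = 0) => by simp [hx]

theorem isZIdeal_c0Ideal (F : ZFilter 𝕜 X) : IsZIdeal F.c0Ideal :=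
  ⟨isIdeal_c0Ideal F, fun _ hf g h => F.mem_of_superset _ hf _ (zeroSet_mem g) h⟩

theorem isPrimeIdeal_c0Ideal {F : ZFilter 𝕜 X} (hF : F.IsPrime) (h : F.c0Ideal ≠ ⊤) :
    IsPrimeIdeal F.c0Ideal := by
  refine ⟨isIdeal_c0Ideal F, h, fun f g hfg => ?_⟩
  by_contra! hf
  refine hF _ (zeroSet_mem f) _ (zeroSet_mem g) hf.1 hf.2 ?_
  have hfg : {x | (f * g) x = 0} ∈ F.sets := hfg
  simpa [ofPred_or] using hfg

theorem pseudoFinite_c0Ideal {P : ι → ZFilter 𝕜 X} (h : PseudoFinite fun α => (P α).sets) :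
    PseudoFinite fun α => ((P α).c0Ideal : Set C₀(X, 𝕜)) := by
  intro f hf
  obtain ⟨α, hα⟩ := mem_iUnion.1 hf
  exact h {x | f x = 0} (mem_iUnion_of_mem α hα)

theorem nonRedundant_of_forall_exists {Y : Type*} {P : ι → Set Y}
    (h : ∀ α, ∃ y, y ∉ P α ∧ ∀ β ≠ α, y ∈ P β) : NonRedundant P := by
  intro T hT hcon
  obtain ⟨α, hα⟩ := (ne_univ_iff_exists_notMem T).1 hT
  obtain ⟨y, hy, hyP⟩ := h α
  have hyT : y ∈ ⋂ i ∈ T, P i := mem_iInter₂.2 fun β hβ => hyP β (ne_of_mem_of_not_mem hβ hα)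
  exact hy (mem_iInter.1 (hcon ▸ hyT) α)

variable (𝕜) in
/-- The prime `z`-filter formed by the zero sets that belong to the ultrafilter `u`. -/
def zFilterOf (u : Ultrafilter X) : ZFilter 𝕜 X where
  sets := {Z | Z ∈ zeroSets 𝕜 X ∧ Z ∈ u}
  subset_zeroSets := fun _ h => h.1
  nonempty := ⟨univ, ⟨0, by simp⟩, univ_mem⟩
  proper := fun h => by
    have hempty : (∅ : Set X) ∈ zeroSets 𝕜 X := ⟨1, by simp⟩
    exact u.empty_notMem (h.symm.subset hempty).2
  inter_mem := by
    rintro _ ⟨⟨f, rfl⟩, hf⟩ _ ⟨⟨g, rfl⟩, hg⟩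
    refine ⟨⟨⟨fun x => ((‖f x‖ + ‖g x‖ : ℝ) : 𝕜), by fun_prop⟩, ?_⟩, inter_mem hf hg⟩
    ext x
    simp only [mem_inter_iff, mem_ofPred_eq, ContinuousMap.coe_mk, RCLike.ofReal_eq_zero]
    rw [add_eq_zero_iff_of_nonneg (norm_nonneg _) (norm_nonneg _), norm_eq_zero, norm_eq_zero]
  mem_of_superset := fun _ h₁ _ h₂ h => ⟨h₂, mem_of_superset h₁.2 h⟩

theorem isPrime_zFilterOf (u : Ultrafilter X) : (zFilterOf 𝕜 u).IsPrime := by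
  rintro Z₁ hZ₁ Z₂ hZ₂ h₁ h₂ ⟨-, h⟩
  exact (Ultrafilter.union_mem_iff.1 h).elim (fun h => h₁ ⟨hZ₁, h⟩) fun h => h₂ ⟨hZ₂, h⟩

theorem mem_c0Ideal_zFilterOf {u : Ultrafilter X} {f : C₀(X, 𝕜)} :
    f ∈ (zFilterOf 𝕜 u).c0Ideal ↔ {x | f x = 0} ∈ u :=
  ⟨fun h => h.2, fun h => ⟨zeroSet_mem f, h⟩⟩

theorem pseudoFinite_zFilterOf {u : ι → Ultrafilter X}
    (h : ∀ Z, IsClosed Z → ∀ α, Z ∈ u α → {β | Z ∉ u β}.Finite) :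
    PseudoFinite fun α => (zFilterOf 𝕜 (u α)).sets := by
  intro Z hZ
  obtain ⟨α, hα⟩ := mem_iUnion.1 hZ
  exact (h Z (isClosed_of_mem_zeroSets hα.1) α hα.2).subset fun β hβ h => hβ ⟨hα.1, h⟩

variable (𝕜) in
theorem exists_mem_c0Ideal_zFilterOf_iff_ne {u : ι → Ultrafilter X} {G : ι → Set X}
    (hG : ∀ α, IsC0Cozero (G α)) (hu : ∀ α β, G α ∈ u β ↔ β = α) (α : ι) :
    ∃ f : C₀(X, 𝕜), ∀ β, f ∈ (zFilterOf 𝕜 (u β)).c0Ideal ↔ β ≠ α := by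
  obtain ⟨f, hf⟩ := (hG α).exists_c0_eq_zero_iff 𝕜
  have hfG : {x | f x = 0} = (G α)ᶜ := Set.ext hf
  exact ⟨f, fun β => by
    rw [mem_c0Ideal_zFilterOf, hfG, Ultrafilter.compl_mem_iff_notMem, hu, ne_eq]⟩

end ZFilters

section Support

variable {𝕜 : Type*} [RCLike 𝕜] {X : Type*} [TopologicalSpace X] {p : OnePoint X}

theorem hasOpenBasis_comap_coe_nhds : HasOpenBasis (comap ((↑) : X → OnePoint X) (𝓝 p)) := by
  rintro s ⟨t, ht, hts⟩
  refine mem_of_superset (preimage_mem_comap (interior_mem_nhds.2 ht)) ?_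
  exact interior_maximal ((preimage_mono interior_subset).trans hts)
    (isOpen_interior.preimage OnePoint.continuous_coe)

theorem exists_c0_ne_zero_of_ne [LocallyCompactSpace X] [T2Space X] {q : X}
    (hq : (q : OnePoint X) ≠ p) :
    ∃ f : C₀(X, 𝕜), f q ≠ 0 ∧ ∀ᶠ x in comap ((↑) : X → OnePoint X) (𝓝 p), f x = 0 := by
  obtain ⟨A, B, hA, hB, hqA, hpB, hAB⟩ := t2_separation hq
  obtain ⟨V, hVA, hV, hqV⟩ :=
    exists_isC0Cozero_subset (OnePoint.continuous_coe.continuousAt (hA.mem_nhds hqA))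
  obtain ⟨f, hf⟩ := hV.exists_c0_eq_zero_iff 𝕜
  refine ⟨f, fun h => (hf q).1 h hqV, mem_of_superset (preimage_mem_comap (hB.mem_nhds hpB)) ?_⟩
  exact fun x hxB => (hf x).2 fun hxV => disjoint_left.1 hAB (hVA hxV) hxB

theorem mem_of_isClosed_of_le_comap_coe_nhds {u : Ultrafilter X} {p : X}
    (hu : ↑u ≤ comap ((↑) : X → OnePoint X) (𝓝 p)) {Z : Set X} (hZ : IsClosed Z) (hZu : Z ∈ u) :
    p ∈ Z := by
  rw [OnePoint.comap_coe_nhds] at hu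
  exact hZ.closure_subset (mem_closure_iff_ultrafilter.2 ⟨u, hZu, hu⟩)

variable [LocallyCompactSpace X] [T2Space X] {u : Ultrafilter X}

theorem eq_of_forall_mem_c0Ideal_zFilterOf (hu : ↑u ≤ comap ((↑) : X → OnePoint X) (𝓝 p)) {q : X}
    (hq : ∀ f ∈ (zFilterOf 𝕜 u).c0Ideal, f q = 0) : (q : OnePoint X) = p := by
  by_contra hne
  obtain ⟨f, hfq, hf⟩ := exists_c0_ne_zero_of_ne (𝕜 := 𝕜) hne
  exact hfq (hq f (mem_c0Ideal_zFilterOf.2 (hu hf)))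

theorem supportedAt_zFilterOf (hu : ↑u ≤ comap ((↑) : X → OnePoint X) (𝓝 p)) :
    (zFilterOf 𝕜 u).SupportedAt p := by
  induction p using OnePoint.rec with
  | infty =>
    rintro ⟨q, hq⟩
    exact OnePoint.coe_ne_infty q
      (eq_of_forall_mem_c0Ideal_zFilterOf (𝕜 := 𝕜) hu fun f hf => hq _ hf)
  | coe p =>
    exact fun Z hZ => mem_of_isClosed_of_le_comap_coe_nhds hu (isClosed_of_mem_zeroSets hZ.1) hZ.2

theorem idealSupportedAt_c0Ideal_zFilterOf (hu : ↑u ≤ comap ((↑) : X → OnePoint X) (𝓝 p)) :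
    IdealSupportedAt (zFilterOf 𝕜 u).c0Ideal p := by
  induction p using OnePoint.rec with
  | infty => exact fun ⟨q, hq⟩ =>
      OnePoint.coe_ne_infty q (eq_of_forall_mem_c0Ideal_zFilterOf hu hq)
  | coe p =>
    refine fun q =>
      ⟨fun hq => OnePoint.coe_injective (eq_of_forall_mem_c0Ideal_zFilterOf hu hq), ?_⟩
    rintro rfl f hf
    exact supportedAt_zFilterOf (𝕜 := 𝕜) hu _ hf

end Support

section Quotient

variable {𝕜 : Type*} [RCLike 𝕜] {X : Type*} [TopologicalSpace X]

variable (𝕜) in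
theorem mk_rclike : #𝕜 = 𝔠 := by
  refine le_antisymm ?_ (continuum_le_cardinal_of_module 𝕜 𝕜)
  have hinj : Function.Injective fun z : 𝕜 => (RCLike.re z, RCLike.im z) := fun z w h =>
    RCLike.ext (congrArg Prod.fst h) (congrArg Prod.snd h)
  simpa [Cardinal.mk_real] using Cardinal.lift_mk_le_lift_mk_of_injective hinj

theorem mk_quotient_eq_continuum {I : Submodule 𝕜 C₀(X, 𝕜)} (hI : I ≠ ⊤) {S : Set X}
    (hS : S.Countable) (h : ∀ f : C₀(X, 𝕜), (∀ x ∈ S, f x = 0) → f ∈ I) :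
    #(C₀(X, 𝕜) ⧸ I) = 𝔠 := by
  have : Nontrivial (C₀(X, 𝕜) ⧸ I) := Submodule.Quotient.nontrivial_iff.2 hI
  refine le_antisymm ?_ (continuum_le_cardinal_of_module 𝕜 (C₀(X, 𝕜) ⧸ I))
  let r (a : C₀(X, 𝕜) ⧸ I) (x : S) : 𝕜 := Quotient.out a x
  have hr : Function.Injective r := by
    intro a b hab
    rw [← Quotient.out_eq a, ← Quotient.out_eq b]
    refine (Submodule.Quotient.eq I).2 (h _ fun x hx => ?_)
    rw [ZeroAtInftyContinuousMap.sub_apply, sub_eq_zero]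
    exact congrFun hab ⟨x, hx⟩
  have hcard : #(S → 𝕜) ≤ 𝔠 := by
    rw [Cardinal.mk_arrow, mk_rclike 𝕜, Cardinal.lift_continuum]
    exact (Cardinal.power_le_power_left Cardinal.continuum_ne_zero
      (Cardinal.lift_le_aleph0.2 (Cardinal.mk_le_aleph0_iff.2 hS))).trans_eq
      Cardinal.continuum_power_aleph0
  simpa using (Cardinal.lift_mk_le_lift_mk_of_injective hr).trans (Cardinal.lift_le.2 hcard)

end Quotient

section Construction

variable {X ι : Type*} [TopologicalSpace X] [LocallyCompactSpace X] [T2Space X]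
  [FirstCountableTopology X]

theorem exists_ultrafilters_isC0Cozero_family {p : OnePoint X} {x : ℕ → X}
    (hxl : ∀ n, (x n : OnePoint X) ∈ cbLevel (OnePoint X) n)
    (hxp : ∀ n, (x n : OnePoint X) ≠ p) (hx : Tendsto (fun n => (x n : OnePoint X)) atTop (𝓝 p))
    (hι : #ι ≤ 𝔠) :
    ∃ (u : ι → Ultrafilter X) (G : ι → Set X) (S : Set X),
      (∀ α, ↑(u α) ≤ comap ((↑) : X → OnePoint X) (𝓝 p)) ∧
      (∀ Z, IsClosed Z → ∀ α, Z ∈ u α → {β | Z ∉ u β}.Finite) ∧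
      (∀ α, IsC0Cozero (G α)) ∧ (∀ α β, G α ∈ u β ↔ β = α) ∧
      S.Countable ∧ ∀ α, S ∈ u α := by
  obtain ⟨φ, hφ, U, hUo, hxU, -, hU⟩ := exists_subseq_disjoint_open hx hxp
  obtain ⟨L, hL, G, ⟨S, hSL, hS⟩, hG, hne, hcl⟩ :=
    exists_filter_isC0Cozero_family (ι := ι) hasOpenBasis_comap_coe_nhds
      (E := fun n => ((↑) : X → OnePoint X) ⁻¹' cbLevel (OnePoint X) n) (x := x ∘ φ)
      (V := fun n => ((↑) : X → OnePoint X) ⁻¹' U n)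
      (fun n y hy => accPt_preimage_coe (accPt_of_mem_cbLevel_succ hy))
      (fun n => antitone_cbLevel (hφ.id_le n) (hxl (φ n)))
      (fun n => ((hUo n).preimage OnePoint.continuous_coe).mem_nhds (hxU n))
      (fun m n hmn => (hU hmn).preimage _)
      (tendsto_comap_iff.2 (hx.comp hφ.tendsto_atTop)) hι
  obtain ⟨u, huL, huG, hu⟩ := exists_ultrafilters_finite_notMem hcl
  have huL' α : ↑(u α) ≤ L := (huL α).trans inf_le_left
  refine ⟨u, G, S, fun α => (huL' α).trans hL, hu, hG, fun α β => ⟨fun h => ?_, ?_⟩, hS,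
    fun α => huL' α hSL⟩
  · by_contra hβ
    exact Ultrafilter.compl_mem_iff_notMem.1 (huL β (compl_mem_avoiding (Ne.symm hβ))) h
  · rintro rfl
    exact huG β

end Construction

end PrimeZ

theorem theorem3p7_general {𝕜 : Type*} [RCLike 𝕜]
    {Ω : Type*} [TopologicalSpace Ω] [LocallyCompactSpace Ω] [T2Space Ω] [FirstCountableTopology Ω]
    {p : OnePoint Ω} {x : ℕ → Ω}
    (hxl : ∀ n, (x n : OnePoint Ω) ∈ PrimeZ.cbLevel (OnePoint Ω) n)
    (hxp : ∀ n, (x n : OnePoint Ω) ≠ p) (hx : Tendsto (fun n => (x n : OnePoint Ω)) atTop (𝓝 p))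
    {ι : Type*} [Nonempty ι] (hι : Cardinal.mk ι ≤ Cardinal.continuum) :
    ∃ P : ι → PrimeZ.ZFilter 𝕜 Ω,
      (∀ α, (P α).IsPrime) ∧
      PrimeZ.PseudoFinite (fun α => (P α).sets) ∧
      PrimeZ.NonRedundant (fun α => (P α).sets) ∧
      (∀ α, (P α).SupportedAt p) ∧
      (∀ α, PrimeZ.IsPrimeIdeal (P α).c0Ideal ∧ PrimeZ.IsZIdeal (P α).c0Ideal) ∧
      PrimeZ.PseudoFinite (fun α => ((P α).c0Ideal : Set C₀(Ω, 𝕜))) ∧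
      PrimeZ.NonRedundant (fun α => ((P α).c0Ideal : Set C₀(Ω, 𝕜))) ∧
      (∀ α, PrimeZ.IdealSupportedAt (P α).c0Ideal p) ∧
      Cardinal.mk (C₀(Ω, 𝕜) ⧸ ⨅ α, (P α).c0Ideal) = Cardinal.continuum := by
  open PrimeZ in
  obtain ⟨u, G, S, hup, hu, hG, huG, hS, huS⟩ :=
    exists_ultrafilters_isC0Cozero_family hxl hxp hx hι
  choose f hf using exists_mem_c0Ideal_zFilterOf_iff_ne 𝕜 hG huG
  have hfα α : f α ∉ (zFilterOf 𝕜 (u α)).c0Ideal := fun h => (hf α α).1 h rfl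
  have hfβ α β (hβ : β ≠ α) : f α ∈ (zFilterOf 𝕜 (u β)).c0Ideal := (hf α β).2 hβ
  have hne α : (zFilterOf 𝕜 (u α)).c0Ideal ≠ ⊤ := fun h => hfα α (h ▸ Submodule.mem_top)
  have hpf := pseudoFinite_zFilterOf (𝕜 := 𝕜) hu
  refine ⟨fun α => zFilterOf 𝕜 (u α), fun α => isPrime_zFilterOf _, hpf,
    nonRedundant_of_forall_exists fun α => ⟨{x | f α x = 0}, hfα α, hfβ α⟩,
    fun α => supportedAt_zFilterOf (hup α),
    fun α => ⟨isPrimeIdeal_c0Ideal (isPrime_zFilterOf _) (hne α), isZIdeal_c0Ideal _⟩,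
    pseudoFinite_c0Ideal hpf, nonRedundant_of_forall_exists fun α => ⟨f α, hfα α, hfβ α⟩,
    fun α => idealSupportedAt_c0Ideal_zFilterOf (hup α), ?_⟩
  refine mk_quotient_eq_continuum (fun htop => ?_) hS fun g hg => ?_
  · exact hne (Classical.arbitrary ι) (iInf_eq_top.1 htop _)
  · exact Submodule.mem_iInf _ |>.2 fun α =>
      mem_c0Ideal_zFilterOf.2 (mem_of_superset (huS α) hg)

theorem theorem3p7 {𝕜 : Type*} [RCLike 𝕜]
    {Ω : Type*} [TopologicalSpace Ω] [LocallyCompactSpace Ω] [TopologicalSpace.MetrizableSpace Ω]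
    (p : OnePoint Ω) (hp : p ∈ PrimeZ.cbLevelInfty (OnePoint Ω))
    {ι : Type*} (hι : Cardinal.mk ι = Cardinal.continuum) :
    ∃ P : ι → PrimeZ.ZFilter 𝕜 Ω,
      (∀ α, (P α).IsPrime) ∧
      PrimeZ.PseudoFinite (fun α => (P α).sets) ∧
      PrimeZ.NonRedundant (fun α => (P α).sets) ∧
      (∀ α, (P α).SupportedAt p) ∧
      (∀ α, PrimeZ.IsPrimeIdeal (P α).c0Ideal ∧ PrimeZ.IsZIdeal (P α).c0Ideal) ∧
      PrimeZ.PseudoFinite (fun α => ((P α).c0Ideal : Set C₀(Ω, 𝕜))) ∧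
      PrimeZ.NonRedundant (fun α => ((P α).c0Ideal : Set C₀(Ω, 𝕜))) ∧
      (∀ α, PrimeZ.IdealSupportedAt (P α).c0Ideal p) ∧
      Cardinal.mk (C₀(Ω, 𝕜) ⧸ ⨅ α, (P α).c0Ideal) = Cardinal.continuum := by
  obtain ⟨x, hxl, hxp, hx⟩ := PrimeZ.exists_seq_tendsto_of_mem_cbLevelInfty hp
  have : Nonempty ι := Cardinal.mk_ne_zero_iff.1 (hι ▸ Cardinal.continuum_ne_zero)
  exact theorem3p7_general hxl hxp hx hι.le
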